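/- Let $m_1,m_2,m_3>0$, $k\in\mathbb R\setminus\{0\}$, $S_2=m_1m_2+m_2m_3+m_3m_1$, $S_3=m_2+2m_3$, and $$z_0=\frac{\sqrt3\,m_1m_2}{2S_2},\qquad z_1=\frac{m_1(\sqrt3\,m_2+iS_3)}{2S_2},\qquad z_2=\frac{m_1(\sqrt3\,m_2-iS_3)}{2S_2}=\overline{z_1},\qquad \Gamma=\mathbb C\setminus\{z_0,z_1,z_2\}.$$ Consider the Fuchsian system $$\frac{dx}{dz}=\Bigl(\frac{A}{z-z_0}+\frac{B}{z-z_1}+\frac{C}{z-z_2}\Bigr)x,\qquad x\in\mathbb C^4,\quad A,B,C\in M(4,\mathbb C).\tag{1}$$ (a) Suppose that (1) is the normal variational equation, written in real linear normal coordinates, of the planar three-body problem with masses $m_i$ and angular momentum $k$ (in Whittaker's Hamiltonian form with variables $q_r,p_r$, $r=1,2,3$) along its Lagrangian parabolic equilateral orbit, parametrised by $z=q_1p_1/k$. Here, with $H$ the Hamiltonian and $X_H$ its vector field, real linear normal coordinates are $x=\Phi(z)\delta$ for variations $\delta\in\ker dH$, where $\Phi$ is a $4\times 6$ matrix function holomorphic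 on $\Gamma$ with $\Phi(\bar z)=\overline{\Phi(z)}$, whose kernel in $\ker dH$ is spanned by $X_H$. Then $A$ is real, and $B=R+iJ$, $C=R-iJ$ with $R,J\in M(4,\mathbb R)$. (b) Suppose that $A\in M(4,\mathbb R)$, $B=R+iJ$ and $C=R-iJ$ with $R,J\in M(4,\mathbb R)$. Let $\gamma_1,\gamma_2$ be loops based at $z=0$ that go once counterclockwise around $z_1$ and $z_2$ respectively; that is, $\gamma_j$ is homotopic in $\Gamma$, with fixed base point, to the loop that follows the straight segment from $0$ towards $z_j$, runs once counterclockwise along the circle of radius $\tfrac12|\operatorname{Im}z_j|$ around $z_j$, and returns along the segment. Let $\Sigma$ be the fundamental matrix solution of (1) near $z=0$ with $\Sigma(0)=\mathrm{Id}$. Then for $j=1,2$ there is a unique matrix $T_j$ such that analytic continuation along $\gamma_j$ carries $\Sigma$ to $\Sigma\,T_j$; moreover $T_j\in \mathrm{GL}(4,\mathbb C)$, and $$T_2=\overline{T_1}^{\,-1}.$$ -/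

import Mathlib

open scoped Matrix Topology unitInterval

noncomputable section

namespace ThreeBody

/-- Three positive masses. -/
structure Masses where
  m₁ : ℝ
  m₂ : ℝ
  m₃ : ℝ
  pos₁ : 0 < m₁
  pos₂ : 0 < m₂
  pos₃ : 0 < m₃

/-- `S₁ = m₁ + m₂ + m₃`. -/
def S₁ (m : Masses) : ℝ := m.m₁ + m.m₂ + m.m₃

/-- `S₂ = m₁ m₂ + m₂ m₃ + m₃ m₁`. -/
def S₂ (m : Masses) : ℝ := m.m₁ * m.m₂ + m.m₂ * m.m₃ + m.m₃ * m.m₁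

/-- `S₃ = m₂ + 2 m₃`. -/
def S₃ (m : Masses) : ℝ := m.m₂ + 2 * m.m₃

/-- `z₀ = √3 m₁ m₂ / (2 S₂)`. -/
def z₀ (m : Masses) : ℂ := ((√3 * m.m₁ * m.m₂ / (2 * S₂ m) : ℝ) : ℂ)

/-- `z₁ = m₁ (√3 m₂ + i S₃) / (2 S₂)`. -/
def z₁ (m : Masses) : ℂ :=
  (m.m₁ : ℂ) * (((√3 * m.m₂ : ℝ) : ℂ) + Complex.I * (S₃ m : ℂ)) / (2 * (S₂ m : ℂ))

/-- `z₂ = m₁ (√3 m₂ - i S₃) / (2 S₂)`. -/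
def z₂ (m : Masses) : ℂ :=
  (m.m₁ : ℂ) * (((√3 * m.m₂ : ℝ) : ℂ) - Complex.I * (S₃ m : ℂ)) / (2 * (S₂ m : ℂ))

/-- `Γ = ℂ \ {z₀, z₁, z₂}`. -/
def Γ (m : Masses) : Set ℂ := {z | z ≠ z₀ m ∧ z ≠ z₁ m ∧ z ≠ z₂ m}

/-! ## The planar three-body problem and its normal variational equation -/

/-- Complexified phase space; `y (inl i)` are `q₁, q₂, q₃` and `y (inr i)` are `p₁, p₂, p₃`. -/
abbrev Phase : Type := Fin 3 ⊕ Fin 3 → ℂ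

/-- The Hamiltonian of the planar three-body problem in Whittaker's variables with angular
momentum `k`. The distances `r₂ = √(q₂² + q₃²)` and `r₃ = √((q₁ - q₂)² + q₃²)` are written as
`q₁ √((q₂² + q₃²) / q₁²)` and `q₁ √(((q₁ - q₂)² + q₃²) / q₁²)`: this agrees with the usual
formula for real `q` with `q₁ > 0`, and is holomorphic near the complexified equilateral
configurations, where both quotients are equal to `1`. -/
def hamiltonian (m : Masses) (k : ℝ) (y : Phase) : ℂ :=
  let q₁ := y (Sum.inl 0)
  let q₂ := y (Sum.inl 1)
  let q₃ := y (Sum.inl 2)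
  let p₁ := y (Sum.inr 0)
  let p₂ := y (Sum.inr 1)
  let p₃ := y (Sum.inr 2)
  let P := p₃ * q₂ - p₂ * q₃ - k
  let M₁ : ℂ := (m.m₃ : ℂ)⁻¹ + (m.m₁ : ℂ)⁻¹
  let M₂ : ℂ := (m.m₃ : ℂ)⁻¹ + (m.m₂ : ℂ)⁻¹
  let r₁ := q₁
  let r₂ := q₁ * ((q₂ ^ 2 + q₃ ^ 2) / q₁ ^ 2) ^ (1 / 2 : ℂ)
  let r₃ := q₁ * (((q₁ - q₂) ^ 2 + q₃ ^ 2) / q₁ ^ 2) ^ (1 / 2 : ℂ)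
  M₁ / 2 * (p₁ ^ 2 + 1 / q₁ ^ 2 * P ^ 2) + M₂ / 2 * (p₂ ^ 2 + p₃ ^ 2)
    + 1 / (m.m₃ : ℂ) * (p₁ * p₂ - p₃ / q₁ * P)
    - m.m₁ * m.m₃ / r₁ - m.m₃ * m.m₂ / r₂ - m.m₁ * m.m₂ / r₃

/-- The partial derivative of `f` at `y` with respect to the coordinate `i`. -/
def partialDeriv (i : Fin 3 ⊕ Fin 3) (f : Phase → ℂ) (y : Phase) : ℂ :=
  lineDeriv ℂ f y (Pi.single i 1)

/-- The Hamiltonian vector field: `q̇ᵣ = ∂H/∂pᵣ`, `ṗᵣ = -∂H/∂qᵣ`. -/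
def hamVectorField (m : Masses) (k : ℝ) (y : Phase) : Phase
  | Sum.inl i => partialDeriv (Sum.inr i) (hamiltonian m k) y
  | Sum.inr i => -partialDeriv (Sum.inl i) (hamiltonian m k) y

/-- The Jacobian matrix of the Hamiltonian vector field. -/
def linearization (m : Masses) (k : ℝ) (y : Phase) : Matrix (Fin 3 ⊕ Fin 3) (Fin 3 ⊕ Fin 3) ℂ :=
  Matrix.of fun i j => partialDeriv j (fun x => hamVectorField m k x i) y

/-- `dH(y)(δ)`. -/
def dHamiltonian (m : Masses) (k : ℝ) (y δ : Phase) : ℂ :=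
  ∑ i, partialDeriv i (hamiltonian m k) y * δ i

/-- With `r = q₁` the side of the equilateral triangle, `h = r² φ̇` for its rotation angle `φ`. -/
def orbitH (m : Masses) (k : ℝ) : ℂ := ((k * S₁ m / S₂ m : ℝ) : ℂ)

/-- The product `r ṙ` along the orbit. -/
def orbitS (m : Masses) (k : ℝ) (z : ℂ) : ℂ :=
  ((2 * k * S₁ m / (m.m₁ * S₃ m) : ℝ) : ℂ) * (z - z₀ m)

/-- The side `r` of the triangle along the orbit of zero energy, from `(r ṙ)² + h² = 2 S₁ r`. -/
def orbitR (m : Masses) (k : ℝ) (z : ℂ) : ℂ :=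
  (orbitS m k z ^ 2 + orbitH m k ^ 2) / (2 * (S₁ m : ℂ))

/-- The Lagrangian parabolic equilateral orbit with angular momentum `k`, parametrised by
`z = q₁ p₁ / k`: `q = (r, r / 2, √3 r / 2)`, the energy is zero, and
`d(orbit)/dz = dt/dz • hamVectorField`. -/
def lagrangeOrbit (m : Masses) (k : ℝ) (z : ℂ) : Phase :=
  let r := orbitR m k z
  let s := orbitS m k z
  let h := orbitH m k
  Sum.elim
    ![r, r / 2, (√3 : ℝ) / 2 * r]
    ![k * z / r,
      m.m₂ / (2 * S₁ m * r) * ((m.m₃ - m.m₁) * s - (√3 : ℝ) * (m.m₁ + m.m₃) * h),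
      m.m₂ / (2 * S₁ m * r) * ((√3 : ℝ) * (m.m₁ + m.m₃) * s + (m.m₃ - m.m₁) * h)]

/-- `dt/dz` along the Lagrangian parabolic orbit. -/
def timeDeriv (m : Masses) (k : ℝ) (z : ℂ) : ℂ :=
  2 * k * orbitR m k z / (m.m₁ * S₃ m)

/-- The coefficient matrix `A / (z - z₀) + B / (z - z₁) + C / (z - z₂)`. -/
def coeffMatrix (m : Masses) (A B C : Matrix (Fin 4) (Fin 4) ℂ) (z : ℂ) :
    Matrix (Fin 4) (Fin 4) ℂ :=
  (z - z₀ m)⁻¹ • A + (z - z₁ m)⁻¹ • B + (z - z₂ m)⁻¹ • C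

/-- `dx/dz = (A / (z - z₀) + B / (z - z₁) + C / (z - z₂)) x` is the normal variational equation
of the three-body problem along the Lagrangian parabolic orbit, written in real normal
coordinates.

The variational equation along the orbit is `dδ/dz = (dt/dz) DX(orbit z) δ`, with `X` the
Hamiltonian vector field. Its normal reduction lives on the 4-dimensional spaces
`ker dH / ⟨X⟩` along the orbit. Linear coordinates on these spaces are `x = Φ(z) δ`, for a
matrix `Φ(z)` whose kernel in `ker dH` is the line spanned by `X`; the normal variational
equation in these coordinates is the equation for `x`. The three-body problem is real and so
are the coordinates: `Φ` commutes with complex conjugation. -/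
def IsNormalVariationalEquation (m : Masses) (k : ℝ) (A B C : Matrix (Fin 4) (Fin 4) ℂ) : Prop :=
  ∃ Φ : ℂ → Matrix (Fin 4) (Fin 3 ⊕ Fin 3) ℂ,
    (∀ z ∈ Γ m, ∀ i j, AnalyticAt ℂ (fun w => Φ w i j) z) ∧
    (∀ z ∈ Γ m, Φ (starRingEnd ℂ z) = (Φ z).map (starRingEnd ℂ)) ∧
    (∀ z ∈ Γ m, ∀ δ : Phase, dHamiltonian m k (lagrangeOrbit m k z) δ = 0 →
      (Φ z *ᵥ δ = 0 ↔ ∃ c : ℂ, δ = c • hamVectorField m k (lagrangeOrbit m k z))) ∧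
    (∀ z ∈ Γ m, ∀ δ : Phase, dHamiltonian m k (lagrangeOrbit m k z) δ = 0 →
      (Matrix.of (fun i j => deriv (fun w => Φ w i j) z)
          + timeDeriv m k z • (Φ z * linearization m k (lagrangeOrbit m k z))) *ᵥ δ
        = coeffMatrix m A B C z *ᵥ (Φ z *ᵥ δ))

/-- The real structure: `A` is real and `C` is the complex conjugate of `B`. -/
def HasRealStructure (A B C : Matrix (Fin 4) (Fin 4) ℂ) : Prop :=
  (∃ A' : Matrix (Fin 4) (Fin 4) ℝ, A = A'.map Complex.ofReal) ∧
    ∃ R J : Matrix (Fin 4) (Fin 4) ℝ,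
      B = R.map Complex.ofReal + Complex.I • J.map Complex.ofReal ∧
      C = R.map Complex.ofReal - Complex.I • J.map Complex.ofReal

/-! ## Loops and monodromy -/

/-- The circle `t ↦ ζ - ρ ζ e^{2πit}` around `ζ`, run once counterclockwise from `ζ - ρ ζ`. -/
def circleLoop (ζ : ℂ) (ρ : ℝ) : Path (ζ - ρ * ζ) (ζ - ρ * ζ) where
  toFun t := ζ - ρ * ζ * Complex.exp (2 * Real.pi * Complex.I * ((t : ℝ) : ℂ))
  continuous_toFun := by fun_prop
  source' := by simp
  target' := by simp

/-- The standard loop from `0` around `ζ`: go along the straight segment from `0` towards `ζ` up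
to distance `ρ ‖ζ‖`, turn once counterclockwise around `ζ`, and return along the segment. -/
def lasso (ζ : ℂ) (ρ : ℝ) : Path (0 : ℂ) 0 :=
  (Path.segment 0 (ζ - ρ * ζ)).trans
    ((circleLoop ζ ρ).trans (Path.segment 0 (ζ - ρ * ζ)).symm)

/-- `γ` and `γ'` are homotopic with fixed endpoints inside the set `U`. -/
def HomotopicIn (U : Set ℂ) {a b : ℂ} (γ γ' : Path a b) : Prop :=
  ∃ H : γ.Homotopy γ', ∀ x, H x ∈ U

/-- `γ` represents the generator of `π₁(Γ, 0)` that goes once counterclockwise around the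
(non-real) singular point `ζ`: it is homotopic in `Γ` to the standard loop around `ζ` whose circle
has radius `|Im ζ| / 2`. -/
def IsGeneratorAround (m : Masses) (ζ : ℂ) (γ : Path (0 : ℂ) 0) : Prop :=
  HomotopicIn (Γ m) γ (lasso ζ (|ζ.im| / (2 * ‖ζ‖)))

/-- `F t` is, for every `t`, a matrix function holomorphic near `γ t`, and these germs are the
analytic continuation of the germ of `F 0` along `γ`. -/
def IsContinuationAlong {a b : ℂ} (γ : Path a b) (F : I → ℂ → Matrix (Fin 4) (Fin 4) ℂ) : Prop :=
  (∀ t i j, AnalyticAt ℂ (fun z => F t z i j) (γ t)) ∧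
    ∀ t, ∀ᶠ s in 𝓝 t, F s =ᶠ[𝓝 (γ s)] F t

/-- `T` is the monodromy matrix of `dx/dz = M(z) x` along the loop `γ` based at `e`: the
fundamental matrix solution `Σ` near `e` with `Σ(e) = Id`, continued analytically along `γ`,
becomes `Σ T`. -/
def IsMonodromyMatrix (M : ℂ → Matrix (Fin 4) (Fin 4) ℂ) {e : ℂ} (γ : Path e e)
    (T : Matrix (Fin 4) (Fin 4) ℂ) : Prop :=
  ∃ F : I → ℂ → Matrix (Fin 4) (Fin 4) ℂ,
    F 0 e = 1 ∧
    (∀ᶠ z in 𝓝 e, ∀ i j, HasDerivAt (fun w => F 0 w i j) ((M z * F 0 z) i j) z) ∧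
    IsContinuationAlong γ F ∧
    F 1 =ᶠ[𝓝 e] fun z => F 0 z * T

end ThreeBody

end

/-!
*Reality of the normal variational equation.* Complex derivatives commute with complex conjugation,
so at a real point of `Γ`, where the orbit is real and the square roots in the Hamiltonian are away
from their branch cut, the differential `dH`, the linearised vector field, `Φ` and `Φ'` are all
real. Hence the coefficient matrix and its conjugate act in the same way on the vectors `Φ δ` with
`δ ∈ ker dH`. Since `ker dH` has dimension at least `5` and the kernel of `Φ` in it is contained in
a line, these vectors fill `ℂ⁴` (`exists_mem_ker_eq`), and the coefficient matrix is real
(`conj_coeffMatrix_of_isNormalVariationalEquation`). The singular points `z₁`, `z₂` are conjugate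
and `z₀` is real, so uniqueness of partial fractions (`eq_zero_of_partialFractions`) gives `A = Ā`
and `C = B̄`.

*Monodromy.* Near every point where `M` is analytic the equation `Y' = M Y` has an invertible
solution, given by a power series, and every other solution is its product with a constant
(`exists_fundamental`). The solutions therefore form a local system. Its pullback along a continuous
map is a covering space, so over a simply connected space, for instance an interval or the square
parametrising a homotopy, flat sections with any given value at a point exist (`exists_isFlat`), and
over a connected space they are unique (`IsFlat.eq_of_eq`). Flat sections over a path are exactly
the analytic continuations of solutions (`isMonodromyMatrix_iff`), and their final values depend
only on the homotopy class of the path (`IsFlat.eq_of_homotopy`). If the equation is real,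
conjugation maps flat sections over the standard loop around `z₁` to flat sections over its mirror
image, which is the standard loop around `z₂` with the opposite orientation; comparing the two
(`IsFlat.lasso_conj`) gives `T₂ T̄₁ = 1`.
-/

noncomputable section

namespace ThreeBody

/-! ### Linear differential equations in Banach algebras -/

section LinearODE

variable {𝔸 : Type*} [NormedRing 𝔸] [NormedAlgebra ℂ 𝔸]

/-- `Y` solves `dY/dz = M Y` in a neighbourhood of `p`. -/
def SolvesNear (M Y : ℂ → 𝔸) (p : ℂ) : Prop :=
  ∀ᶠ z in 𝓝 p, HasDerivAt Y (M z * Y z) z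

/-- The Taylor coefficients of the solution of `Y' = M Y`, `Y = 1` at the centre, where `a` are the
Taylor coefficients of `M`: they satisfy `(n + 1) bₙ₊₁ = ∑ aᵢ bₙ₋ᵢ`. -/
def solutionCoeff (a : ℕ → 𝔸) : ℕ → 𝔸
  | 0 => 1
  | n + 1 => ((n : ℂ) + 1)⁻¹ • ∑ i : Fin (n + 1), a i * solutionCoeff a (n - i)
termination_by n => n
decreasing_by omega

theorem smul_solutionCoeff_succ (a : ℕ → 𝔸) (n : ℕ) :
    ((n : ℂ) + 1) • solutionCoeff a (n + 1)
      = ∑ i ∈ Finset.range (n + 1), a i * solutionCoeff a (n - i) := by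
  rw [solutionCoeff, smul_inv_smul₀ (by exact_mod_cast n.succ_ne_zero),
    Fin.sum_univ_eq_sum_range (fun i => a i * solutionCoeff a (n - i))]

/-- The method of majorants: geometric growth of the coefficients of `M` bounds those of the
solution. -/
theorem norm_solutionCoeff_le {a : ℕ → 𝔸} {K ρ R : ℝ} (hρ : 0 ≤ ρ) (hK : 0 ≤ K)
    (ha : ∀ n, ‖a n‖ ≤ K * ρ ^ n) (hρR : ρ ≤ R) (hKR : K ≤ R) (n : ℕ) :
    ‖solutionCoeff a n‖ ≤ ‖(1 : 𝔸)‖ * R ^ n := by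
  induction n using Nat.strong_induction_on with
  | _ n ih =>
  have hR : 0 ≤ R := hρ.trans hρR
  rcases n with _ | n
  · simp [solutionCoeff]
  · have hn : (0 : ℝ) < n + 1 := by positivity
    have hsum : ‖((n : ℂ) + 1) • solutionCoeff a (n + 1)‖
        ≤ (n + 1) * (K * (‖(1 : 𝔸)‖ * R ^ n)) := by
      rw [smul_solutionCoeff_succ]
      refine (norm_sum_le_of_le (n := fun _ => K * (‖(1 : 𝔸)‖ * R ^ n)) _ fun i hi => ?_).trans
        (by simp)
      have hi' : i ≤ n := by simpa [Nat.lt_succ_iff] using hi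
      calc ‖a i * solutionCoeff a (n - i)‖
          ≤ ‖a i‖ * ‖solutionCoeff a (n - i)‖ := norm_mul_le _ _
        _ ≤ (K * R ^ i) * (‖(1 : 𝔸)‖ * R ^ (n - i)) := by
            gcongr
            · exact (ha i).trans (by gcongr)
            · exact ih _ (by omega)
        _ = K * (‖(1 : 𝔸)‖ * R ^ n) := by
            rw [← Nat.add_sub_cancel' hi', pow_add, Nat.add_sub_cancel_left]; ring
    have hnorm : ‖((n : ℂ) + 1)‖ = n + 1 := by
      have := Complex.norm_natCast (n + 1)
      push_cast at this
      exact this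
    rw [norm_smul, hnorm, mul_le_mul_iff_right₀ hn] at hsum
    calc _ ≤ K * (‖(1 : 𝔸)‖ * R ^ n) := hsum
      _ ≤ R * (‖(1 : 𝔸)‖ * R ^ n) := by gcongr
      _ = ‖(1 : 𝔸)‖ * R ^ (n + 1) := by ring

theorem SolvesNear.mul_const {M Y : ℂ → 𝔸} {p : ℂ} (hY : SolvesNear M Y p) (c : 𝔸) :
    SolvesNear M (fun z => Y z * c) p := by
  filter_upwards [hY] with z hz
  simpa only [mul_assoc] using hz.mul_const c

variable [CompleteSpace 𝔸]

/-- Termwise differentiation of a power series with geometrically bounded coefficients. -/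
theorem hasDerivAt_tsum_pow_smul {b : ℕ → 𝔸} {L R : ℝ} (hR : 0 < R)
    (hb : ∀ n, ‖b n‖ ≤ L * R ^ n) {p z : ℂ} (hz : ‖z - p‖ < 1 / (2 * R)) :
    HasDerivAt (fun z => ∑' n, (z - p) ^ n • b n)
      (∑' n : ℕ, ((n : ℂ) * (z - p) ^ (n - 1)) • b n) z := by
  have hL : 0 ≤ L := (norm_nonneg (b 0)).trans (by simpa using hb 0)
  have hu : Summable fun n : ℕ => 2 * R * L * ((n : ℝ) ^ 1 * (1 / 2 : ℝ) ^ n) :=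
    Summable.mul_left _ (summable_pow_mul_geometric_of_norm_lt_one (R := ℝ) 1 (by norm_num))
  have hpball : p ∈ Metric.ball p (1 / (2 * R)) := Metric.mem_ball_self (by positivity)
  have hp : Summable fun n => (p - p) ^ n • b n :=
    (hasSum_single 0 fun n hn => by simp [hn]).summable
  refine hasDerivAt_tsum_of_isPreconnected (g := fun n z => (z - p) ^ n • b n)
    (g' := fun n z => ((n : ℂ) * (z - p) ^ (n - 1)) • b n) hu Metric.isOpen_ball
    (convex_ball p (1 / (2 * R))).isPreconnected (fun n y _ => ?_) (fun n y hy => ?_) hpball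
    hp (mem_ball_iff_norm.2 hz)
  · simpa only [id, mul_one] using
      (((hasDerivAt_id y).sub_const p).fun_pow n).smul_const (b n)
  · rcases n with _ | n
    · simp
    have hy' : ‖y - p‖ * R ≤ 1 / 2 := by
      calc ‖y - p‖ * R ≤ 1 / (2 * R) * R := by gcongr; exact (mem_ball_iff_norm.1 hy).le
        _ = 1 / 2 := by field_simp
    rw [norm_smul, norm_mul, norm_pow, Nat.add_sub_cancel, Complex.norm_natCast]
    calc ((n + 1 : ℕ) : ℝ) * ‖y - p‖ ^ n * ‖b (n + 1)‖
        ≤ ((n + 1 : ℕ) : ℝ) * ‖y - p‖ ^ n * (L * R ^ (n + 1)) := by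
          gcongr; exact hb _
      _ = R * L * (((n + 1 : ℕ) : ℝ) * (‖y - p‖ * R) ^ n) := by rw [mul_pow]; ring
      _ ≤ R * L * (((n + 1 : ℕ) : ℝ) * (1 / 2) ^ n) := by gcongr
      _ = _ := by rw [pow_succ (1 / 2 : ℝ)]; ring

/-- Cauchy's existence theorem for linear equations, by power series. -/
theorem exists_solvesNear {M : ℂ → 𝔸} {p : ℂ} (hM : AnalyticAt ℂ M p) :
    ∃ Y : ℂ → 𝔸, Y p = 1 ∧ SolvesNear M Y p := by
  obtain ⟨P, hP⟩ := hM
  obtain ⟨K, ρ, hK, hρ, ha⟩ := P.le_mul_pow_of_radius_pos hP.radius_pos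
  set a : ℕ → 𝔸 := P.coeff with ha_def
  have ha : ∀ n, ‖a n‖ ≤ K * ρ ^ n := fun n => by
    rw [ha_def, ← FormalMultilinearSeries.norm_apply_eq_norm_coef]; exact ha n
  set b := solutionCoeff a with hb_def
  set R := K + ρ with hR_def
  have hR : 0 < R := by positivity
  have hb : ∀ n, ‖b n‖ ≤ ‖(1 : 𝔸)‖ * R ^ n :=
    norm_solutionCoeff_le hρ.le hK.le ha (by linarith) (by linarith)
  have hgeom : Summable fun n : ℕ => ((1 : ℝ) / 2) ^ n := summable_geometric_two
  -- On the disc of radius `1 / (2 R)` all series below are dominated by geometric ones.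
  have hball : ∀ z ∈ Metric.ball p (1 / (2 * R)), ‖z - p‖ * R ≤ 1 / 2 := fun z hz => by
    rw [mem_ball_iff_norm] at hz
    calc ‖z - p‖ * R ≤ 1 / (2 * R) * R := by gcongr
      _ = 1 / 2 := by field_simp
  have hsumb : ∀ z ∈ Metric.ball p (1 / (2 * R)), Summable fun n => ‖(z - p) ^ n • b n‖ := by
    intro z hz
    refine Summable.of_nonneg_of_le (fun _ => norm_nonneg _) (fun n => ?_)
      (hgeom.mul_left ‖(1 : 𝔸)‖)
    rw [norm_smul, norm_pow]
    calc ‖z - p‖ ^ n * ‖b n‖ ≤ ‖z - p‖ ^ n * (‖(1 : 𝔸)‖ * R ^ n) := by gcongr; exact hb n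
      _ = ‖(1 : 𝔸)‖ * (‖z - p‖ * R) ^ n := by rw [mul_pow]; ring
      _ ≤ ‖(1 : 𝔸)‖ * (1 / 2) ^ n := by gcongr; exact hball z hz
  have hsuma : ∀ z ∈ Metric.ball p (1 / (2 * R)), Summable fun n => ‖(z - p) ^ n • a n‖ := by
    intro z hz
    refine Summable.of_nonneg_of_le (fun _ => norm_nonneg _) (fun n => ?_) (hgeom.mul_left K)
    rw [norm_smul, norm_pow]
    calc ‖z - p‖ ^ n * ‖a n‖ ≤ ‖z - p‖ ^ n * (K * R ^ n) := by
          gcongr; exact (ha n).trans (by gcongr; linarith)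
      _ = K * (‖z - p‖ * R) ^ n := by rw [mul_pow]; ring
      _ ≤ K * (1 / 2) ^ n := by gcongr; exact hball z hz
  refine ⟨fun z => ∑' n, (z - p) ^ n • b n, ?_, ?_⟩
  · beta_reduce
    rw [tsum_eq_single 0 fun n hn => by simp [hn]]
    simp [hb_def, solutionCoeff]
  filter_upwards [hasFPowerSeriesAt_iff'.1 hP, Metric.ball_mem_nhds p
    (show 0 < 1 / (2 * R) by positivity)] with z hMz hz
  have hder : HasDerivAt (fun z => ∑' n, (z - p) ^ n • b n)
      (∑' n : ℕ, ((n : ℂ) * (z - p) ^ (n - 1)) • b n) z :=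
    hasDerivAt_tsum_pow_smul hR hb (mem_ball_iff_norm.1 hz)
  have hcoef : ∀ n : ℕ, (((n + 1 : ℕ) : ℂ) * (z - p) ^ (n + 1 - 1)) • b (n + 1)
      = ∑ i ∈ Finset.range (n + 1), ((z - p) ^ i • a i) * ((z - p) ^ (n - i) • b (n - i)) := by
    intro n
    rw [Nat.add_sub_cancel, mul_comm, mul_smul]
    push_cast
    rw [hb_def, smul_solutionCoeff_succ, Finset.smul_sum]
    refine Finset.sum_congr rfl fun i hi => ?_
    have hi' : i ≤ n := by simpa [Nat.lt_succ_iff] using hi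
    rw [smul_mul_smul_comm, ← pow_add, Nat.add_sub_cancel' hi']
  have hbz := hsumb z hz
  convert hder using 1
  rw [← hMz.tsum_eq, tsum_mul_tsum_eq_tsum_sum_range_of_summable_norm (hsuma z hz) hbz,
    tsum_eq_zero_add' (f := fun n : ℕ => ((n : ℂ) * (z - p) ^ (n - 1)) • b n)]
  · rw [Nat.cast_zero, zero_mul, zero_smul, zero_add]
    exact tsum_congr fun n => (hcoef n).symm
  · exact ((summable_norm_sum_mul_range_of_summable_norm (hsuma z hz) hbz).of_norm).congr
      fun n => (hcoef n).symm

/-- Near every point where `M` is analytic there is a fundamental solution: it is invertible, and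
every other solution on a smaller disc is its product with a constant. The last part holds because
`Y⁻¹ W` has derivative `-Y⁻¹ M W + Y⁻¹ M W = 0`. -/
theorem exists_fundamental {M : ℂ → 𝔸} {p : ℂ} (hM : AnalyticAt ℂ M p) :
    ∃ (Y : ℂ → 𝔸) (r : ℝ), 0 < r ∧ Y p = 1 ∧
      (∀ z ∈ Metric.ball p r, IsUnit (Y z) ∧ HasDerivAt Y (M z * Y z) z) ∧
      ∀ q ∈ Metric.ball p r, ∀ W, SolvesNear M W q →
        ∀ᶠ z in 𝓝 q, W z = Y z * (Ring.inverse (Y q) * W q) := by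
  obtain ⟨Y, hY1, hY⟩ := exists_solvesNear hM
  have hunit : ∀ᶠ z in 𝓝 p, IsUnit (Y z) :=
    hY.self_of_nhds.continuousAt.eventually
      (Units.isOpen.mem_nhds (show IsUnit (Y p) by rw [hY1]; exact isUnit_one))
  obtain ⟨r, hr, h⟩ := Metric.eventually_nhds_iff_ball.1 (hunit.and hY)
  refine ⟨Y, r, hr, hY1, h, fun q hq W hW => ?_⟩
  obtain ⟨ε, hε, hball⟩ := Metric.eventually_nhds_iff_ball.1
    (hW.and (Metric.isOpen_ball.mem_nhds hq))
  have hder : ∀ z ∈ Metric.ball q ε, HasDerivAt (fun z => Ring.inverse (Y z) * W z) 0 z := by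
    intro z hz
    obtain ⟨hWz, hzr⟩ := hball z hz
    obtain ⟨⟨u, hu⟩, hYz⟩ := h z hzr
    have hinv : HasDerivAt (fun z => Ring.inverse (Y z))
        (-(Ring.inverse (Y z) * (M z * Y z) * Ring.inverse (Y z))) z := by
      have := hasFDerivAt_ringInverse (𝕜 := ℂ) u
      rw [hu] at this
      simpa [← hu, Ring.inverse_unit, Function.comp_def] using! this.comp_hasDerivAt z hYz
    convert! hinv.mul hWz using 1
    rw [← hu, Ring.inverse_unit]
    simp [mul_assoc]
  have hconst : ∀ z ∈ Metric.ball q ε,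
      Ring.inverse (Y z) * W z = Ring.inverse (Y q) * W q := by
    intro z hz
    refine Metric.isOpen_ball.is_const_of_deriv_eq_zero (convex_ball q ε).isPreconnected
      (fun x hx => (hder x hx).differentiableAt.differentiableWithinAt)
      (fun x hx => (hder x hx).deriv) hz (Metric.mem_ball_self hε)
  filter_upwards [Metric.ball_mem_nhds q hε] with z hz
  rw [← hconst z hz, Ring.mul_inverse_cancel_left _ _ (h z (hball z hz).2).1]

/-- Solutions with the same value at `p` have the same germ there. -/
theorem SolvesNear.eventuallyEq {M Y W : ℂ → 𝔸} {p : ℂ} (hM : AnalyticAt ℂ M p)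
    (hY : SolvesNear M Y p) (hW : SolvesNear M W p) (h : Y p = W p) : Y =ᶠ[𝓝 p] W := by
  obtain ⟨V, r, hr, -, -, huniq⟩ := exists_fundamental hM
  have hp := Metric.mem_ball_self (x := p) hr
  filter_upwards [huniq p hp Y hY, huniq p hp W hW] with z h1 h2
  rw [h1, h2, h]

end LinearODE

/-! ### Parallel transport of solutions -/

section Flat

variable {𝔸 : Type*} [NormedRing 𝔸] [NormedAlgebra ℂ 𝔸] {X : Type*} [TopologicalSpace X]

/-- `v` is a flat section over the map `f : X → ℂ` of the local system of solutions of
`dY/dz = M Y`: near every point, `v` is the restriction along `f` of one local solution. For a path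
`f`, this says that `v` is the analytic continuation of a solution along `f`, recorded by its
values. -/
def IsFlat (M : ℂ → 𝔸) (f : X → ℂ) (v : X → 𝔸) : Prop :=
  ∀ x, ∃ Y, SolvesNear M Y (f x) ∧ ∀ᶠ s in 𝓝 x, v s = Y (f s)

variable {M : ℂ → 𝔸} {f : X → ℂ} {v w : X → 𝔸}

theorem IsFlat.comp {X' : Type*} [TopologicalSpace X'] (hv : IsFlat M f v) {g : X' → X}
    (hg : Continuous g) : IsFlat M (fun x => f (g x)) (fun x => v (g x)) := fun x =>
  let ⟨Y, hY, h⟩ := hv (g x)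
  ⟨Y, hY, hg.continuousAt.eventually h⟩

theorem IsFlat.mul_const (hv : IsFlat M f v) (c : 𝔸) : IsFlat M f (fun x => v x * c) := fun x =>
  let ⟨Y, hY, h⟩ := hv x
  ⟨_, hY.mul_const c, h.mono fun s hs => by simp only [hs]⟩

variable [CompleteSpace 𝔸]

theorem isFlat_const {e : ℂ} (hM : AnalyticAt ℂ M e) (c : 𝔸) :
    IsFlat M (fun _ : X => e) (fun _ => c) := fun _ =>
  let ⟨Y, h1, hY⟩ := exists_solvesNear hM
  ⟨_, hY.mul_const c, by simp [h1]⟩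

/-- Two flat sections are, near every point, constant multiples of the same invertible section. -/
theorem IsFlat.exists_local_frame (hv : IsFlat M f v) (hw : IsFlat M f w) (hf : Continuous f)
    (hM : ∀ x, AnalyticAt ℂ M (f x)) (x : X) :
    ∃ (Y : X → 𝔸) (c d : 𝔸), ∀ᶠ s in 𝓝 x, IsUnit (Y s) ∧ v s = Y s * c ∧ w s = Y s * d := by
  obtain ⟨Y, r, hr, -, hY, huniq⟩ := exists_fundamental (hM x)
  have hx := Metric.mem_ball_self (x := f x) hr
  obtain ⟨V, hV, hvV⟩ := hv x
  obtain ⟨W, hW, hwW⟩ := hw x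
  refine ⟨fun s => Y (f s), Ring.inverse (Y (f x)) * V (f x),
    Ring.inverse (Y (f x)) * W (f x), ?_⟩
  filter_upwards [hvV, hwW, hf.continuousAt.eventually (huniq _ hx V hV),
    hf.continuousAt.eventually (huniq _ hx W hW),
    hf.continuousAt.eventually (Metric.ball_mem_nhds _ hr)] with s h1 h2 h3 h4 h5
  exact ⟨(hY _ h5).1, h1.trans h3, h2.trans h4⟩

theorem IsFlat.eq_of_eq [PreconnectedSpace X] (hv : IsFlat M f v) (hw : IsFlat M f w)
    (hf : Continuous f) (hM : ∀ x, AnalyticAt ℂ M (f x)) {x₀ : X} (h₀ : v x₀ = w x₀) (x : X) :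
    v x = w x := by
  have hloc : IsLocallyConstant fun x => v x = w x := by
    refine (IsLocallyConstant.iff_eventually_eq _).2 fun x => ?_
    obtain ⟨Y, c, d, h⟩ := hv.exists_local_frame hw hf hM x
    have key : ∀ s, IsUnit (Y s) ∧ v s = Y s * c ∧ w s = Y s * d → ((v s = w s) = (c = d)) :=
      fun s ⟨hu, h1, h2⟩ => propext (by rw [h1, h2]; exact hu.mul_right_inj)
    filter_upwards [h] with s hs
    rw [key s hs, key x h.self_of_nhds]
  exact (hloc.apply_eq_of_isPreconnected isPreconnected_univ trivial trivial).mp h₀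

theorem IsFlat.isUnit [PreconnectedSpace X] (hv : IsFlat M f v) (hf : Continuous f)
    (hM : ∀ x, AnalyticAt ℂ M (f x)) {x₀ : X} (h₀ : IsUnit (v x₀)) (x : X) : IsUnit (v x) := by
  have hloc : IsLocallyConstant fun x => IsUnit (v x) := by
    refine (IsLocallyConstant.iff_eventually_eq _).2 fun x => ?_
    obtain ⟨Y, c, d, h⟩ := hv.exists_local_frame hv hf hM x
    have key : ∀ s, IsUnit (Y s) ∧ v s = Y s * c ∧ v s = Y s * d → (IsUnit (v s) = IsUnit c) :=
      fun s ⟨⟨u, hu⟩, h1, _⟩ => propext (by rw [h1, ← hu, Units.isUnit_units_mul])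
    filter_upwards [h] with s hs
    rw [key s hs, key x h.self_of_nhds]
  exact (hloc.apply_eq_of_isPreconnected isPreconnected_univ trivial trivial).mp h₀

/-- A copy of the type `α`, to be given the discrete topology. -/
structure DiscreteCopy (α : Type*) where
  /-- The point of `α` of which this is the copy. -/
  val : α

instance (α : Type*) : TopologicalSpace (DiscreteCopy α) := ⊥

instance (α : Type*) : DiscreteTopology (DiscreteCopy α) := ⟨rfl⟩

/-- The pullback along `f` of the local system of solutions, as a bundle with discrete fibre: the
charts are given by fundamental solutions `Y i` on the discs with centre `f i` and radius `r i`. -/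
def solutionBundle (M : ℂ → 𝔸) (f : X → ℂ) (hf : Continuous f) (Y : X → ℂ → 𝔸) (r : X → ℝ)
    (hr : ∀ x, 0 < r x)
    (hY : ∀ x, ∀ z ∈ Metric.ball (f x) (r x), IsUnit (Y x z) ∧ HasDerivAt (Y x) (M z * Y x z) z)
    (huniq : ∀ x, ∀ q ∈ Metric.ball (f x) (r x), ∀ W, SolvesNear M W q →
      ∀ᶠ z in 𝓝 q, W z = Y x z * (Ring.inverse (Y x q) * W q)) :
    FiberBundleCore X X (DiscreteCopy 𝔸) where
  baseSet i := f ⁻¹' Metric.ball (f i) (r i)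
  isOpen_baseSet i := Metric.isOpen_ball.preimage hf
  indexAt := id
  mem_baseSet_at x := Metric.mem_ball_self (hr x)
  coordChange i j x v := ⟨Ring.inverse (Y j (f x)) * Y i (f x) * v.val⟩
  coordChange_self i x hx v := by rw [Ring.inverse_mul_cancel _ (hY i _ hx).1, one_mul]
  continuousOn_coordChange i j := by
    rintro ⟨x, v⟩ ⟨⟨hi, hj⟩, -⟩
    -- On overlaps two fundamental solutions differ by a constant, so the transition is constant.
    have hsol : SolvesNear M (Y i) (f x) := by
      filter_upwards [Metric.isOpen_ball.mem_nhds hi] with z hz using (hY i z hz).2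
    have h1 := hf.continuousAt.eventually (huniq j _ hj _ hsol)
    have h2 := (Metric.isOpen_ball.preimage hf).mem_nhds hj
    refine ContinuousAt.continuousWithinAt (ContinuousAt.congr (f := fun _ =>
      (⟨Ring.inverse (Y j (f x)) * Y i (f x) * v.val⟩ : DiscreteCopy 𝔸)) continuousAt_const ?_)
    rw [Filter.EventuallyEq, nhds_prod_eq, nhds_discrete (DiscreteCopy 𝔸), Filter.prod_pure]
    refine Filter.eventually_map.2 ?_
    filter_upwards [h1, h2] with s hs hsj
    rw [hs, Ring.inverse_mul_cancel_left _ _ (hY j _ hsj).1]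
  coordChange_comp i j k x hx v := by
    simp only
    rw [mul_assoc, ← mul_assoc (Y j (f x)), Ring.mul_inverse_cancel_left _ _ (hY j _ hx.1.2).1,
      mul_assoc]

/-- Over a simply connected space every solution at a point extends to a flat section, because the
local system of solutions is a covering space. -/
theorem exists_isFlat [SimplyConnectedSpace X] [LocallyPathConnectedSpace X] (hf : Continuous f)
    (hM : ∀ x, AnalyticAt ℂ M (f x)) (x₀ : X) (c : 𝔸) : ∃ v, IsFlat M f v ∧ v x₀ = c := by
  choose Y r hr hY1 hY huniq using fun x => exists_fundamental (hM x)
  set Z := solutionBundle M f hf Y r hr hY huniq with hZ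
  have hcov : IsCoveringMap Z.proj := FiberBundle.isCoveringMap (F := DiscreteCopy 𝔸) (E := Z.Fiber)
  obtain ⟨G, ⟨hG0, hG⟩, -⟩ := hcov.existsUnique_continuousMap_lifts (ContinuousMap.id X) x₀
    (⟨x₀, ⟨c⟩⟩ : Z.TotalSpace) rfl
  have hG : ∀ x, (G x).proj = x := fun x => congrFun hG x
  -- In the chart at `i` the section is `Y i ∘ f` times a locally constant function.
  refine ⟨fun x => (Y x (f x) * DiscreteCopy.val (G x).2), fun x => ?_, ?_⟩
  · have hcont : ContinuousAt (fun s => (Z.localTriv x (G s)).2) x := by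
      refine continuousAt_snd.comp (ContinuousAt.comp ?_ G.continuous.continuousAt)
      refine (Z.localTriv x).continuousAt ?_
      rw [Z.mem_localTriv_source, hG]
      exact Metric.mem_ball_self (hr x)
    have hconst : ∀ᶠ s in 𝓝 x, (Z.localTriv x (G s)).2 = (Z.localTriv x (G x)).2 :=
      
      Filter.tendsto_pure.1 (by rw [← nhds_discrete (DiscreteCopy 𝔸)]; exact hcont)
    refine ⟨fun z => Y x z * (Z.localTriv x (G x)).2.val, SolvesNear.mul_const ?_ _, ?_⟩
    · filter_upwards [Metric.ball_mem_nhds (f x) (hr x)] with z hz using (hY x z hz).2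
    · filter_upwards [hconst, (Metric.isOpen_ball.preimage hf).mem_nhds
        (Metric.mem_ball_self (hr x) : f x ∈ Metric.ball (f x) (r x))] with s hs hsx
      rw [← hs, Z.localTriv_apply]
      change _ = Y x (f s) * (Ring.inverse (Y x (f (G s).proj)) * Y (G s).proj (f (G s).proj)
        * DiscreteCopy.val (G s).2)
      rw [hG, mul_assoc, Ring.mul_inverse_cancel_left _ _ (hY x _ hsx).1]
  · beta_reduce
    rw [hG0, hY1]
    exact one_mul c

end Flat

/-! ### Transport along paths and loops -/

section Transport

variable {𝔸 : Type*} [NormedRing 𝔸] [NormedAlgebra ℂ 𝔸] [CompleteSpace 𝔸] {M : ℂ → 𝔸}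

theorem exists_isFlat_square {f : I × I → ℂ} (hf : Continuous f) (hM : ∀ x, AnalyticAt ℂ M (f x))
    (c : 𝔸) : ∃ v, IsFlat M f v ∧ v (0, 0) = c := by
  -- The square is a retract of the plane, which is simply and locally path connected.
  let pr : ℝ → I := Set.projIcc 0 1 zero_le_one
  have hpr : Continuous fun x : ℝ × ℝ => (pr x.1, pr x.2) := by
    have : Continuous pr := continuous_projIcc
    fun_prop
  obtain ⟨v, hv, hv0⟩ := exists_isFlat (M := M) (hf.comp hpr) (fun x => hM _) (0, 0) c
  refine ⟨fun x => v (x.1, x.2), ?_, hv0⟩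
  have := hv.comp (g := fun x : I × I => ((x.1 : ℝ), (x.2 : ℝ))) (by fun_prop)
  simpa [pr] using this

theorem exists_isFlat_path {f : I → ℂ} (hf : Continuous f) (hM : ∀ x, AnalyticAt ℂ M (f x))
    (c : 𝔸) : ∃ v, IsFlat M f v ∧ v 0 = c := by
  obtain ⟨v, hv, hv0⟩ := exists_isFlat_square (M := M) (hf.comp continuous_fst)
    (fun x => hM x.1) c
  exact ⟨_, hv.comp (g := fun t : I => (t, (0 : I))) (by fun_prop), hv0⟩

/-- Transport is invariant under homotopies inside the domain of analyticity. -/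
theorem IsFlat.eq_of_homotopy {a b : ℂ} {γ γ' : Path a b} (H : γ.Homotopy γ')
    (hM : ∀ x, AnalyticAt ℂ M (H x)) {v w : I → 𝔸} (hv : IsFlat M γ v) (hw : IsFlat M γ' w)
    (h₀ : v 0 = w 0) : v 1 = w 1 := by
  obtain ⟨V, hV, hV0⟩ := exists_isFlat_square (M := M) H.continuous hM (v 0)
  have hMa : AnalyticAt ℂ M a := by simpa using hM (0, 0)
  have hMb : AnalyticAt ℂ M b := by simpa using hM (0, 1)
  have hγ : ∀ t, AnalyticAt ℂ M (γ t) := fun t => by simpa using hM (0, t)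
  have hγ' : ∀ t, AnalyticAt ℂ M (γ' t) := fun t => by simpa using hM (1, t)
  have bottom := hV.comp (g := fun t : I => ((0 : I), t)) (by fun_prop)
  have top := hV.comp (g := fun t : I => ((1 : I), t)) (by fun_prop)
  have left := hV.comp (g := fun s : I => (s, (0 : I))) (by fun_prop)
  have right := hV.comp (g := fun s : I => (s, (1 : I))) (by fun_prop)
  simp only [ContinuousMap.HomotopyWith.apply_zero, ContinuousMap.HomotopyWith.apply_one,
    Path.Homotopy.source, Path.Homotopy.target, Path.coe_toContinuousMap] at bottom top left right
  have h1 : V (0, 1) = v 1 := bottom.eq_of_eq hv γ.continuous hγ (x₀ := 0) hV0 1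
  have h2 : V (1, 0) = V (0, 0) := left.eq_of_eq (isFlat_const hMa _) continuous_const
    (fun _ => hMa) (x₀ := 0) rfl 1
  have h3 : V (1, 1) = V (0, 1) := right.eq_of_eq (isFlat_const hMb _) continuous_const
    (fun _ => hMb) (x₀ := 0) rfl 1
  have h4 : V (1, 1) = w 1 := top.eq_of_eq hw γ'.continuous hγ' (x₀ := 0)
    (h2.trans (hV0.trans h₀)) 1
  rw [← h1, ← h3, h4]

/-- The affine map of `[0, 1]` onto `[0, 1/2]`. -/
def leftHalf (t : I) : I := ⟨t / 2, by have := t.2.1; positivity, by have := t.2.2; linarith⟩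

/-- The affine map of `[0, 1]` onto `[1/2, 1]`. -/
def rightHalf (t : I) : I :=
  ⟨(1 + t) / 2, by have := t.2.1; positivity, by have := t.2.2; linarith⟩

theorem continuous_leftHalf : Continuous leftHalf := by unfold leftHalf; fun_prop

theorem continuous_rightHalf : Continuous rightHalf := by unfold rightHalf; fun_prop

theorem leftHalf_zero : leftHalf 0 = 0 := by ext; simp [leftHalf]

theorem leftHalf_one : leftHalf 1 = rightHalf 0 := by ext; simp [leftHalf, rightHalf]

theorem rightHalf_one : rightHalf 1 = 1 := by ext; simp [rightHalf]

theorem trans_leftHalf {X : Type*} [TopologicalSpace X] {a b c : X} (γ : Path a b) (γ' : Path b c)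
    (t : I) : γ.trans γ' (leftHalf t) = γ t := by
  have h : (leftHalf t : ℝ) ≤ 1 / 2 := by simp only [leftHalf]; linarith [t.2.2]
  rw [Path.trans_apply, dif_pos h]
  congr 1
  ext
  simp only [leftHalf]; ring

theorem trans_rightHalf {X : Type*} [TopologicalSpace X] {a b c : X} (γ : Path a b)
    (γ' : Path b c) (t : I) : γ.trans γ' (rightHalf t) = γ' t := by
  by_cases ht : t = 0
  · subst ht
    rw [← leftHalf_one, trans_leftHalf, γ.target, γ'.source]
  have h : ¬ (rightHalf t : ℝ) ≤ 1 / 2 := by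
    simp only [rightHalf]
    have ht' : (0 : ℝ) < t := unitInterval.pos_iff_ne_zero.2 ht
    linarith
  rw [Path.trans_apply, dif_neg h]
  congr 1
  ext
  simp only [rightHalf]; ring

/-- Transport along a loop of the form `γ · c · γ⁻¹`: if `P` is the transport along `γ` and `T` the
one along the whole loop, then the section over `c` goes from `P` to `P T`. -/
theorem IsFlat.conjugated_loop {a b : ℂ} {γ : Path a b} {c : Path b b} {v : I → 𝔸}
    (hv : IsFlat M (γ.trans (c.trans γ.symm)) v)
    (hM : ∀ t, AnalyticAt ℂ M (γ.trans (c.trans γ.symm) t)) (h₀ : v 0 = 1) :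
    IsFlat M γ (fun t => v (leftHalf t)) ∧
      IsFlat M c (fun t => v (rightHalf (leftHalf t))) ∧
      v (rightHalf (leftHalf 1)) = v (rightHalf 0) * v 1 := by
  have h1 := hv.comp continuous_leftHalf
  have h2 := hv.comp (continuous_rightHalf.comp continuous_leftHalf)
  have h3 := (hv.comp (continuous_rightHalf.comp continuous_rightHalf)).comp
    unitInterval.continuous_symm
  simp only [Function.comp_apply, trans_leftHalf, trans_rightHalf, Path.symm_apply,
    unitInterval.symm_symm] at h1 h2 h3
  refine ⟨h1, h2, ?_⟩
  have hγ : ∀ t, AnalyticAt ℂ M (γ t) := fun t => by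
    simpa only [trans_leftHalf] using hM (leftHalf t)
  have := h3.eq_of_eq (h1.mul_const (v 1)) γ.continuous hγ (x₀ := 0)
    (by simp [leftHalf_zero, rightHalf_one, h₀]) 1
  simpa [leftHalf_one] using this

end Transport

/-! ### Analytic continuation of matrix solutions -/

section Monodromy

open scoped Matrix.Norms.Operator

variable {n : Type*} [Fintype n]

theorem hasDerivAt_matrix {F : ℂ → Matrix n n ℂ} {F' : Matrix n n ℂ} {z : ℂ} :
    HasDerivAt F F' z ↔ ∀ i j, HasDerivAt (fun w => F w i j) (F' i j) z :=
  hasDerivAt_pi.trans (forall_congr' fun _ => hasDerivAt_pi)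

/-- The identity theorem for germs of matrix functions: for functions analytic at `p` there is a
neighbourhood of `p` such that they agree near all its points if they agree near one. -/
theorem exists_nhds_forall_eventuallyEq {F G : ℂ → Matrix n n ℂ} {p : ℂ}
    (hF : ∀ i j, AnalyticAt ℂ (fun z => F z i j) p) (hG : ∀ i j, AnalyticAt ℂ (fun z => G z i j) p) :
    ∃ U ∈ 𝓝 p, ∀ q ∈ U, F =ᶠ[𝓝 q] G → ∀ x ∈ U, F =ᶠ[𝓝 x] G := by
  have hev : ∀ᶠ z in 𝓝 p, ∀ i j,
      AnalyticAt ℂ (fun z => F z i j) z ∧ AnalyticAt ℂ (fun z => G z i j) z :=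
    Filter.eventually_all.2 fun i => Filter.eventually_all.2 fun j =>
      (hF i j).eventually_analyticAt.and (hG i j).eventually_analyticAt
  obtain ⟨r, hr, h⟩ := Metric.eventually_nhds_iff_ball.1 hev
  refine ⟨Metric.ball p r, Metric.ball_mem_nhds p hr, fun q hq hFG x hx => ?_⟩
  filter_upwards [Metric.isOpen_ball.mem_nhds hx] with z hz
  ext i j
  exact AnalyticOnNhd.eqOn_of_preconnected_of_eventuallyEq (fun y hy => (h y hy i j).1)
    (fun y hy => (h y hy i j).2) (convex_ball p r).isPreconnected hq
    (hFG.mono fun y hy => by simp only [hy]) hz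

variable [DecidableEq n]

theorem SolvesNear.analyticAt_apply {M Y : ℂ → Matrix n n ℂ} {p : ℂ} (hY : SolvesNear M Y p)
    (i j : n) : AnalyticAt ℂ (fun z => Y z i j) p :=
  Complex.analyticAt_iff_eventually_differentiableAt.2 <|
    hY.mono fun _ hz => (hasDerivAt_matrix.1 hz i j).differentiableAt

/-- Analytic continuation along a path is determined by the initial germ. -/
theorem IsContinuationAlong.eventuallyEq {a b : ℂ} {γ : Path a b}
    {F G : I → ℂ → Matrix (Fin 4) (Fin 4) ℂ} (hF : IsContinuationAlong γ F)
    (hG : IsContinuationAlong γ G) (h₀ : F 0 =ᶠ[𝓝 (γ 0)] G 0) (t : I) : F t =ᶠ[𝓝 (γ t)] G t := by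
  have hloc : IsLocallyConstant fun t => F t =ᶠ[𝓝 (γ t)] G t := by
    refine (IsLocallyConstant.iff_eventually_eq _).2 fun t => ?_
    obtain ⟨U, hU, hid⟩ := exists_nhds_forall_eventuallyEq (hF.1 t) (hG.1 t)
    filter_upwards [hF.2 t, hG.2 t, γ.continuous.continuousAt.eventually hU] with s h1 h2 hs
    refine propext ⟨fun h => ?_, fun h => ?_⟩
    · exact hid _ hs (h1.symm.trans (h.trans h2)) _ (mem_of_mem_nhds hU)
    · exact h1.trans ((hid _ (mem_of_mem_nhds hU) h _ hs).trans h2.symm)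
  exact (hloc.apply_eq_of_isPreconnected isPreconnected_univ trivial trivial).mp h₀

/-- The monodromy matrix along a loop is the final value of the flat section starting at `1`. -/
theorem isMonodromyMatrix_iff {M : ℂ → Matrix (Fin 4) (Fin 4) ℂ} {e : ℂ} {γ : Path e e}
    (hM : ∀ t, AnalyticAt ℂ M (γ t)) {v : I → Matrix (Fin 4) (Fin 4) ℂ} (hv : IsFlat M γ v)
    (h₀ : v 0 = 1) (T : Matrix (Fin 4) (Fin 4) ℂ) : IsMonodromyMatrix M γ T ↔ T = v 1 := by
  choose F hF hvF using hv
  have hval : ∀ t, v t = F t (γ t) := fun t => (hvF t).self_of_nhds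
  have hcont : IsContinuationAlong γ F := by
    refine ⟨fun t i j => (hF t).analyticAt_apply i j, fun t => ?_⟩
    filter_upwards [hvF t, γ.continuous.continuousAt.eventually (hF t).eventually_nhds] with s h1 h2
    exact (hF s).eventuallyEq (hM s) h2 ((hval s).symm.trans h1)
  have hMe : AnalyticAt ℂ M e := by simpa using hM 0
  have hF0 : SolvesNear M (F 0) e := by simpa using hF 0
  have hF1 : SolvesNear M (F 1) e := by simpa using hF 1
  have hF0e : F 0 e = 1 := by have := hval 0; rwa [h₀, γ.source, eq_comm] at this
  have hF1e : F 1 e = v 1 := by have := hval 1; rwa [γ.target, eq_comm] at this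
  have hmono : F 1 =ᶠ[𝓝 e] fun z => F 0 z * v 1 :=
    hF1.eventuallyEq hMe (hF0.mul_const _) (by rw [hF0e, hF1e, one_mul])
  constructor
  · rintro ⟨G, hG0, hGd, hGc, hGT⟩
    have hG : SolvesNear M (G 0) e := hGd.mono fun z hz => hasDerivAt_matrix.2 hz
    have h0 : G 0 =ᶠ[𝓝 e] F 0 := hG.eventuallyEq hMe hF0 (by rw [hG0, hF0e])
    have h1 := hGc.eventuallyEq hcont (by simpa using h0) 1
    rw [γ.target] at h1
    have := (hGT.symm.trans (h1.trans hmono)).self_of_nhds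
    simpa [hG0, hF0e] using this
  · rintro rfl
    exact ⟨F, hF0e, hF0.mono fun z hz => hasDerivAt_matrix.1 hz, hcont, hmono⟩

/-- Complex conjugation carries flat sections to flat sections if the equation is real. -/
theorem IsFlat.conj {M : ℂ → Matrix n n ℂ}
    (hM : ∀ z, M (starRingEnd ℂ z) = (M z).map (starRingEnd ℂ)) {X : Type*} [TopologicalSpace X]
    {f : X → ℂ} {v : X → Matrix n n ℂ} (hv : IsFlat M f v) :
    IsFlat M (fun x => starRingEnd ℂ (f x)) (fun x => (v x).map (starRingEnd ℂ)) := by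
  intro x
  obtain ⟨Y, hY, h⟩ := hv x
  refine ⟨fun z => (Y (starRingEnd ℂ z)).map (starRingEnd ℂ), ?_, ?_⟩
  · have hY' : ∀ᶠ z in 𝓝 (f x), HasDerivAt Y (M z * Y z) z := hY
    rw [← Complex.conj_conj (f x)] at hY'
    filter_upwards [Complex.continuous_conj.continuousAt.eventually hY'] with z hz
    refine hasDerivAt_matrix.2 fun i j => ?_
    have := (hasDerivAt_matrix.1 hz i j).conj_conj
    rw [Complex.conj_conj] at this
    convert! this using 1
    have hz' := hM (starRingEnd ℂ z)
    rw [Complex.conj_conj] at hz'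
    rw [hz', ← Matrix.map_mul, Matrix.map_apply]
  · filter_upwards [h] with s hs
    simp only [Complex.conj_conj, hs]

theorem conj_segment (ζ : ℂ) (ρ : ℝ) (t : I) :
    starRingEnd ℂ (Path.segment 0 (ζ - ρ * ζ) t)
      = Path.segment 0 (starRingEnd ℂ ζ - ρ * starRingEnd ℂ ζ) t := by
  simp [AffineMap.lineMap_apply]

/-- Conjugation turns the counterclockwise circle around `ζ` into the clockwise one around `ζ̄`. -/
theorem conj_circleLoop (ζ : ℂ) (ρ : ℝ) (t : I) :
    starRingEnd ℂ (circleLoop ζ ρ t) = circleLoop (starRingEnd ℂ ζ) ρ (unitInterval.symm t) := by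
  have h : starRingEnd ℂ (Complex.exp (2 * Real.pi * Complex.I * ((t : ℝ) : ℂ)))
      = Complex.exp (2 * Real.pi * Complex.I * ((unitInterval.symm t : ℝ) : ℂ)) := by
    rw [← Complex.exp_conj, unitInterval.coe_symm_eq]
    have : 2 * Real.pi * Complex.I * (((1 - t : ℝ)) : ℂ)
        = -(2 * Real.pi * Complex.I * ((t : ℝ) : ℂ)) + 2 * Real.pi * Complex.I := by
      push_cast; ring
    rw [this, Complex.exp_periodic]
    simp [Complex.conj_ofNat]
  simp [circleLoop, h]

/-- Transports along the standard loops around conjugate points are conjugate inverses: conjugation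
maps one loop to the reverse of the other. -/
theorem IsFlat.lasso_conj {M : ℂ → Matrix n n ℂ} {ζ : ℂ} {ρ : ℝ}
    (hMconj : ∀ z, M (starRingEnd ℂ z) = (M z).map (starRingEnd ℂ))
    (hM : ∀ t, AnalyticAt ℂ M (lasso ζ ρ t))
    (hM' : ∀ t, AnalyticAt ℂ M (lasso (starRingEnd ℂ ζ) ρ t)) {v w : I → Matrix n n ℂ}
    (hv : IsFlat M (lasso ζ ρ) v) (hw : IsFlat M (lasso (starRingEnd ℂ ζ) ρ) w)
    (hv₀ : v 0 = 1) (hw₀ : w 0 = 1) : w 1 * (v 1).map (starRingEnd ℂ) = 1 := by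
  obtain ⟨v1, v2, v3⟩ := hv.conjugated_loop hM hv₀
  obtain ⟨w1, w2, w3⟩ := hw.conjugated_loop hM' hw₀
  have hseg : ∀ t, AnalyticAt ℂ M
      (Path.segment 0 (starRingEnd ℂ ζ - ρ * starRingEnd ℂ ζ) t) := fun t => by
    simpa only [lasso, trans_leftHalf] using hM' (leftHalf t)
  have hcirc : ∀ t, AnalyticAt ℂ M (circleLoop (starRingEnd ℂ ζ) ρ t) := fun t => by
    simpa only [lasso, trans_leftHalf, trans_rightHalf] using hM' (rightHalf (leftHalf t))
  have v1' := v1.conj hMconj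
  simp only [conj_segment] at v1'
  have hP : w (rightHalf 0) = (v (rightHalf 0)).map (starRingEnd ℂ) := by
    have := w1.eq_of_eq v1' (Path.continuous _) hseg (x₀ := 0)
      (by simp [leftHalf_zero, hw₀, hv₀, Matrix.map_one]) 1
    simpa only [leftHalf_one] using this
  have v2' := (v2.conj hMconj).comp unitInterval.continuous_symm
  simp only [conj_circleLoop, unitInterval.symm_symm] at v2'
  have key := (w2.mul_const ((v 1).map (starRingEnd ℂ))).eq_of_eq v2' (Path.continuous _) hcirc
    (x₀ := 0) (by
      simp only [unitInterval.symm_zero, v3, leftHalf_zero, hP, Matrix.map_mul]) 1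
  have hunit : IsUnit (w (rightHalf 0)) :=
    hw.isUnit (Path.continuous _) hM' (x₀ := 0) (by rw [hw₀]; exact isUnit_one) _
  simp only [unitInterval.symm_one, w3, leftHalf_zero, ← hP, mul_assoc] at key
  exact hunit.mul_left_cancel (by rw [key, mul_one])

end Monodromy

/-! ### The singular points and the coefficient matrix -/

theorem conj_z₀ (m : Masses) : starRingEnd ℂ (z₀ m) = z₀ m := Complex.conj_ofReal _

theorem conj_z₁ (m : Masses) : starRingEnd ℂ (z₁ m) = z₂ m := by
  simp [z₁, z₂, Complex.conj_ofNat, sub_eq_add_neg]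

theorem conj_z₂ (m : Masses) : starRingEnd ℂ (z₂ m) = z₁ m := by
  rw [← conj_z₁, Complex.conj_conj]

theorem S₂_pos (m : Masses) : 0 < S₂ m := by
  have := m.pos₁; have := m.pos₂; have := m.pos₃
  unfold S₂; positivity

theorem im_z₁ (m : Masses) : (z₁ m).im = m.m₁ * S₃ m / (2 * S₂ m) := by
  have h : z₁ m = ((m.m₁ * (√3 * m.m₂) / (2 * S₂ m) : ℝ) : ℂ)
      + ((m.m₁ * S₃ m / (2 * S₂ m) : ℝ) : ℂ) * Complex.I := by
    simp only [z₁]; push_cast; ring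
  rw [h]
  simp [-Complex.ofReal_div, -Complex.ofReal_mul]

theorem im_z₁_pos (m : Masses) : 0 < (z₁ m).im := by
  have := m.pos₁; have := m.pos₂; have := m.pos₃; have := S₂_pos m
  rw [im_z₁, S₃]; positivity

theorem z₁_ne_z₂ (m : Masses) : z₁ m ≠ z₂ m := fun h => by
  have h' := im_z₁_pos m
  have := congrArg Complex.im h
  rw [← conj_z₁, Complex.conj_im] at this
  linarith

theorem ofReal_ne_z₁ (m : Masses) (x : ℝ) : (x : ℂ) ≠ z₁ m := fun h => by
  have h' := im_z₁_pos m
  rw [← h, Complex.ofReal_im] at h'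
  exact lt_irrefl _ h'

theorem ofReal_ne_z₂ (m : Masses) (x : ℝ) : (x : ℂ) ≠ z₂ m := fun h => by
  apply ofReal_ne_z₁ m x
  rw [← conj_z₂, ← h, Complex.conj_ofReal]

theorem isOpen_Γ (m : Masses) : IsOpen (Γ m) :=
  isOpen_ne.inter (isOpen_ne.inter isOpen_ne)

section

open scoped Matrix.Norms.Operator

theorem analyticAt_coeffMatrix {m : Masses} (A B C : Matrix (Fin 4) (Fin 4) ℂ) {z : ℂ}
    (hz : z ∈ Γ m) : AnalyticAt ℂ (coeffMatrix m A B C) z := by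
  have h : ∀ ζ, z ≠ ζ → ∀ D : Matrix (Fin 4) (Fin 4) ℂ,
      AnalyticAt ℂ (fun w => (w - ζ)⁻¹ • D) z := fun ζ hζ D =>
    ((analyticAt_id.sub analyticAt_const).fun_inv (sub_ne_zero.2 hζ)).fun_smul analyticAt_const
  exact ((h _ hz.1 A).add (h _ hz.2.1 B)).add (h _ hz.2.2 C)

end

theorem conj_coeffMatrix {m : Masses} (A B C : Matrix (Fin 4) (Fin 4) ℂ) (z : ℂ) :
    (coeffMatrix m A B C z).map (starRingEnd ℂ) =
      coeffMatrix m (A.map (starRingEnd ℂ)) (C.map (starRingEnd ℂ)) (B.map (starRingEnd ℂ))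
        (starRingEnd ℂ z) := by
  ext i j
  simp [coeffMatrix, conj_z₀, conj_z₁, conj_z₂]
  ring

theorem hasRealStructure_iff {A B C : Matrix (Fin 4) (Fin 4) ℂ} :
    HasRealStructure A B C ↔ A.map (starRingEnd ℂ) = A ∧ B.map (starRingEnd ℂ) = C := by
  constructor
  · rintro ⟨⟨A', rfl⟩, R, J, rfl, rfl⟩
    constructor
    · ext; simp
    · ext; simp [sub_eq_add_neg]
  · rintro ⟨hA, rfl⟩
    refine ⟨⟨A.map Complex.re, ?_⟩, B.map Complex.re, B.map Complex.im, ?_, ?_⟩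
    · ext i j
      have := congrFun (congrFun hA i) j
      rw [Matrix.map_apply] at this
      simp [Complex.conj_eq_iff_re.1 this]
    · ext i j
      simp [mul_comm Complex.I, Complex.re_add_im]
    · ext i j
      apply Complex.ext <;> simp

/-! ### The monodromy around conjugate singular points -/

section

open scoped Matrix.Norms.Operator

/-- Both monodromies are computed on the standard loops, which are interchanged, up to orientation,
by complex conjugation. -/
theorem monodromy_conj {m : Masses} {A B C : Matrix (Fin 4) (Fin 4) ℂ}
    (h : HasRealStructure A B C) {γ₁ γ₂ : Path (0 : ℂ) 0} (hγ₁ : IsGeneratorAround m (z₁ m) γ₁)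
    (hγ₂ : IsGeneratorAround m (z₂ m) γ₂) :
    ∃ T₁ T₂ : Matrix.GeneralLinearGroup (Fin 4) ℂ,
      (∀ T, IsMonodromyMatrix (coeffMatrix m A B C) γ₁ T ↔ T = ↑T₁) ∧
      (∀ T, IsMonodromyMatrix (coeffMatrix m A B C) γ₂ T ↔ T = ↑T₂) ∧
      T₂ = (Matrix.GeneralLinearGroup.map (starRingEnd ℂ) T₁)⁻¹ := by
  obtain ⟨hA, hB⟩ := hasRealStructure_iff.1 h
  have hC : C.map (starRingEnd ℂ) = B := by rw [← hB]; ext; simp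
  have hconj : ∀ z, coeffMatrix m A B C (starRingEnd ℂ z)
      = (coeffMatrix m A B C z).map (starRingEnd ℂ) := fun z => by
    rw [conj_coeffMatrix, hA, hB, hC]
  rw [← conj_z₁, IsGeneratorAround, Complex.conj_im, abs_neg, Complex.norm_conj] at hγ₂
  obtain ⟨H₁, hH₁⟩ := hγ₁
  obtain ⟨H₂, hH₂⟩ := hγ₂
  have hM : ∀ {z}, z ∈ Γ m → AnalyticAt ℂ (coeffMatrix m A B C) z := analyticAt_coeffMatrix A B C
  have hγ₁ : ∀ t, AnalyticAt ℂ (coeffMatrix m A B C) (γ₁ t) := fun t => hM <| by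
    simpa using hH₁ (0, t)
  have hγ₂ : ∀ t, AnalyticAt ℂ (coeffMatrix m A B C) (γ₂ t) := fun t => hM <| by
    simpa using hH₂ (0, t)
  have hl₁ := fun t => hM (hH₁ (1, t))
  have hl₂ := fun t => hM (hH₂ (1, t))
  simp only [ContinuousMap.HomotopyWith.apply_one, Path.coe_toContinuousMap] at hl₁ hl₂
  obtain ⟨v₁, hv₁, hv₁0⟩ := exists_isFlat_path γ₁.continuous hγ₁ 1
  obtain ⟨v₂, hv₂, hv₂0⟩ := exists_isFlat_path γ₂.continuous hγ₂ 1
  obtain ⟨w₁, hw₁, hw₁0⟩ := exists_isFlat_path (Path.continuous _) hl₁ 1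
  obtain ⟨w₂, hw₂, hw₂0⟩ := exists_isFlat_path (Path.continuous _) hl₂ 1
  have e₁ := hv₁.eq_of_homotopy H₁ (fun x => hM (hH₁ x)) hw₁ (hv₁0.trans hw₁0.symm)
  have e₂ := hv₂.eq_of_homotopy H₂ (fun x => hM (hH₂ x)) hw₂ (hv₂0.trans hw₂0.symm)
  have key := IsFlat.lasso_conj hconj hl₁ hl₂ hw₁ hw₂ hw₁0 hw₂0
  rw [← e₁, ← e₂] at key
  obtain ⟨T₁, hT₁⟩ := hv₁.isUnit γ₁.continuous hγ₁ (x₀ := 0) (by rw [hv₁0]; exact isUnit_one) 1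
  refine ⟨T₁, (Matrix.GeneralLinearGroup.map (starRingEnd ℂ) T₁)⁻¹, fun T => ?_, fun T => ?_, rfl⟩
  · rw [isMonodromyMatrix_iff hγ₁ hv₁ hv₁0, hT₁]
  · rw [isMonodromyMatrix_iff hγ₂ hv₂ hv₂0]
    have : v₂ 1 = ↑(Matrix.GeneralLinearGroup.map (starRingEnd ℂ) T₁)⁻¹ :=
      Units.eq_inv_of_mul_eq_one_right (by rw [← key, ← hT₁]; rfl)
    rw [this]

end

/-! ### Reality of the normal variational equation -/

/-- `f` commutes with complex conjugation near `y`. No regularity of `f` is asked for: complex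
derivatives commute with conjugation in any case. -/
def IsLocallyReal (f : Phase → ℂ) (y : Phase) : Prop :=
  ∀ᶠ x in 𝓝 y, f (star x) = starRingEnd ℂ (f x)

theorem IsLocallyReal.partialDeriv {f : Phase → ℂ} {y : Phase} (hf : IsLocallyReal f y)
    (i : Fin 3 ⊕ Fin 3) : IsLocallyReal (partialDeriv i f) y := by
  filter_upwards [hf.eventually_nhds] with x hx
  have hline : ∀ᶠ t : ℂ in 𝓝 0, f (star (x + starRingEnd ℂ t • Pi.single i 1))
      = starRingEnd ℂ (f (x + starRingEnd ℂ t • Pi.single i 1)) := by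
    have hc : ContinuousAt (fun t : ℂ => x + starRingEnd ℂ t • (Pi.single i 1 : Phase)) 0 := by
      have := Complex.continuous_conj
      fun_prop
    exact hc.eventually (by simpa using hx)
  have hv : star (Pi.single i 1 : Phase) = Pi.single i 1 := by
    rw [← Pi.single_star, star_one]
  simp only [ThreeBody.partialDeriv, lineDeriv]
  have := congrFun (deriv_conj_conj (f := fun t : ℂ => f (x + t • Pi.single i 1))) 0
  rw [Function.comp_apply, Function.comp_apply, map_zero] at this
  rw [← this]
  refine Filter.EventuallyEq.deriv_eq (hline.mono fun t ht => ?_)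
  simp only [Function.comp_apply]
  rw [← ht, star_add, star_smul, hv]
  simp

theorem IsLocallyReal.neg {f : Phase → ℂ} {y : Phase} (hf : IsLocallyReal f y) :
    IsLocallyReal (fun x => -f x) y := by
  filter_upwards [hf] with x hx
  rw [hx, map_neg]

theorem IsLocallyReal.conj_apply {f : Phase → ℂ} {y : Phase} (hf : IsLocallyReal f y)
    (hy : star y = y) : starRingEnd ℂ (f y) = f y := by
  have := hf.self_of_nhds
  rw [hy] at this
  exact this.symm

/-- The Hamiltonian is real where the square roots in it are away from their branch cut. -/
theorem isLocallyReal_hamiltonian (m : Masses) (k : ℝ) {y : Phase} (h0 : y (Sum.inl 0) ≠ 0)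
    (h2 : (y (Sum.inl 1) ^ 2 + y (Sum.inl 2) ^ 2) / y (Sum.inl 0) ^ 2 ∈ Complex.slitPlane)
    (h3 : ((y (Sum.inl 0) - y (Sum.inl 1)) ^ 2 + y (Sum.inl 2) ^ 2) / y (Sum.inl 0) ^ 2
      ∈ Complex.slitPlane) :
    IsLocallyReal (hamiltonian m k) y := by
  have h0' : y (Sum.inl 0) ^ 2 ≠ 0 := pow_ne_zero 2 h0
  have hc : ∀ i, ContinuousAt (fun x : Phase => x i) y := fun i => continuousAt_apply i y
  have c2 : ContinuousAt (fun x : Phase =>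
      (x (Sum.inl 1) ^ 2 + x (Sum.inl 2) ^ 2) / x (Sum.inl 0) ^ 2) y :=
    (((hc _).pow 2).add ((hc _).pow 2)).div ((hc _).pow 2) h0'
  have c3 : ContinuousAt (fun x : Phase =>
      ((x (Sum.inl 0) - x (Sum.inl 1)) ^ 2 + x (Sum.inl 2) ^ 2) / x (Sum.inl 0) ^ 2) y :=
    ((((hc _).sub (hc _)).pow 2).add ((hc _).pow 2)).div ((hc _).pow 2) h0'
  filter_upwards [c2.eventually (Complex.isOpen_slitPlane.mem_nhds h2),
    c3.eventually (Complex.isOpen_slitPlane.mem_nhds h3)] with x hx2 hx3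
  have hsqrt : ∀ w ∈ Complex.slitPlane,
      starRingEnd ℂ (w ^ (1 / 2 : ℂ)) = starRingEnd ℂ w ^ (1 / 2 : ℂ) := fun w hw => by
    rw [Complex.conj_cpow _ _ (Complex.slitPlane_arg_ne_pi hw)]
    simp [Complex.conj_ofNat]
  simp only [hamiltonian, Pi.star_apply, map_sub, map_add, map_mul, map_div₀, map_pow, map_inv₀,
    map_one, hsqrt _ hx2, hsqrt _ hx3, starRingEnd_apply]
  simp only [← starRingEnd_apply, Complex.conj_ofReal, Complex.conj_ofNat]

theorem isLocallyReal_hamVectorField {m : Masses} {k : ℝ} {y : Phase}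
    (h : IsLocallyReal (hamiltonian m k) y) (i : Fin 3 ⊕ Fin 3) :
    IsLocallyReal (fun x => hamVectorField m k x i) y := by
  cases i with
  | inl i => exact h.partialDeriv (Sum.inr i)
  | inr i => exact (h.partialDeriv (Sum.inl i)).neg

theorem S₁_pos (m : Masses) : 0 < S₁ m := by
  have := m.pos₁; have := m.pos₂; have := m.pos₃
  unfold S₁; positivity

theorem star_lagrangeOrbit (m : Masses) (k x : ℝ) :
    star (lagrangeOrbit m k x) = lagrangeOrbit m k x := by
  have hs : starRingEnd ℂ (orbitS m k x) = orbitS m k x := by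
    rw [orbitS, map_mul, map_sub, conj_z₀, Complex.conj_ofReal, Complex.conj_ofReal]
  have hh : starRingEnd ℂ (orbitH m k) = orbitH m k := Complex.conj_ofReal _
  have hr : starRingEnd ℂ (orbitR m k x) = orbitR m k x := by
    simp [orbitR, hs, hh, Complex.conj_ofNat]
  ext i
  rw [Pi.star_apply, ← starRingEnd_apply]
  rcases i with i | i <;> fin_cases i <;>
    simp [lagrangeOrbit, hs, hh, hr, Complex.conj_ofNat]

theorem orbitR_ofReal_ne_zero (m : Masses) {k : ℝ} (hk : k ≠ 0) (x : ℝ) :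
    orbitR m k x ≠ 0 := by
  have h1 := S₁_pos m
  have h2 := S₂_pos m
  have hh : k * S₁ m / S₂ m ≠ 0 := by positivity
  have : orbitR m k x = (((2 * k * S₁ m / (m.m₁ * S₃ m) * (x - √3 * m.m₁ * m.m₂ / (2 * S₂ m))) ^ 2
      + (k * S₁ m / S₂ m) ^ 2) / (2 * S₁ m) : ℝ) := by
    simp only [orbitR, orbitS, orbitH, z₀]; push_cast; ring
  rw [this, Complex.ofReal_ne_zero]
  positivity

/-- At real points the Hamiltonian is real near the Lagrangian orbit: both mutual distances other
than `q₁` equal `q₁` there. -/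
theorem isLocallyReal_hamiltonian_lagrangeOrbit (m : Masses) {k : ℝ} (hk : k ≠ 0) (x : ℝ) :
    IsLocallyReal (hamiltonian m k) (lagrangeOrbit m k x) := by
  have hr := orbitR_ofReal_ne_zero m hk x
  have h3 : ((√3 : ℝ) : ℂ) ^ 2 = 3 := by
    rw [← Complex.ofReal_pow, Real.sq_sqrt (by norm_num)]; norm_num
  apply isLocallyReal_hamiltonian
  · simpa [lagrangeOrbit] using hr
  · convert Complex.one_mem_slitPlane
    simp only [lagrangeOrbit, Sum.elim_inl, Matrix.cons_val]
    field_simp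
    rw [h3]; ring
  · convert Complex.one_mem_slitPlane
    simp only [lagrangeOrbit, Sum.elim_inl, Matrix.cons_val]
    field_simp
    rw [h3]; ring

/-- If `dim V = dim W + 2` and the kernel of `φ` on `ker ℓ` is contained in a line, then
`φ` maps `ker ℓ` onto `W`. -/
theorem exists_mem_ker_eq {K V W : Type*} [Field K] [AddCommGroup V] [Module K V]
    [FiniteDimensional K V] [AddCommGroup W] [Module K W] [FiniteDimensional K W]
    (hdim : Module.finrank K V = Module.finrank K W + 2) (ℓ : V →ₗ[K] K) (φ : V →ₗ[K] W) (X : V)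
    (h : ∀ δ, ℓ δ = 0 → φ δ = 0 → ∃ c : K, δ = c • X) (u : W) : ∃ δ, ℓ δ = 0 ∧ φ δ = u := by
  have hker : Module.finrank K (LinearMap.ker (ℓ.prod φ)) ≤ 1 := by
    refine (Submodule.finrank_mono (t := K ∙ X) fun δ hδ => ?_).trans ?_
    · have hδ : ℓ δ = 0 ∧ φ δ = 0 := Prod.mk_eq_zero.1 (LinearMap.mem_ker.1 hδ)
      obtain ⟨c, hc⟩ := h δ hδ.1 hδ.2
      exact Submodule.mem_span_singleton.2 ⟨c, hc.symm⟩
    · simpa using finrank_span_le_card (R := K) ({X} : Set V)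
  have hrank := (ℓ.prod φ).finrank_range_add_finrank_ker
  have hle := (LinearMap.range (ℓ.prod φ)).finrank_le
  rw [Module.finrank_prod, Module.finrank_self] at hle
  have htop : LinearMap.range (ℓ.prod φ) = ⊤ := by
    apply Submodule.eq_top_of_finrank_eq
    rw [Module.finrank_prod, Module.finrank_self]
    omega
  obtain ⟨δ, hδ⟩ := LinearMap.range_eq_top.1 htop (0, u)
  exact ⟨δ, Prod.mk.inj hδ⟩

theorem star_mulVec_eq {p q : Type*} [Fintype q] (N : Matrix p q ℂ) (δ : q → ℂ) :
    star (N *ᵥ δ) = N.map (starRingEnd ℂ) *ᵥ star δ := by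
  ext i
  simp [Matrix.mulVec, dotProduct]

/-- At real points the coefficient matrix of the normal variational equation is real, because its
action on `Φ δ`, `δ ∈ ker dH`, commutes with conjugation and these vectors exhaust `ℂ⁴`. -/
theorem conj_coeffMatrix_of_isNormalVariationalEquation {m : Masses} {k : ℝ} (hk : k ≠ 0)
    {A B C : Matrix (Fin 4) (Fin 4) ℂ} (h : IsNormalVariationalEquation m k A B C) {x : ℝ}
    (hx : (x : ℂ) ∈ Γ m) :
    (coeffMatrix m A B C x).map (starRingEnd ℂ) = coeffMatrix m A B C x := by
  obtain ⟨Φ, -, hΦconj, hΦker, hΦ⟩ := h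
  set y := lagrangeOrbit m k x with hy
  have hyreal : star y = y := star_lagrangeOrbit m k x
  have hH : IsLocallyReal (hamiltonian m k) y := isLocallyReal_hamiltonian_lagrangeOrbit m hk x
  have hΦx : (Φ x).map (starRingEnd ℂ) = Φ x := by
    rw [← hΦconj _ hx, Complex.conj_ofReal]
  have hderiv : ∀ i j, starRingEnd ℂ (deriv (fun w => Φ w i j) x) = deriv (fun w => Φ w i j) x := by
    intro i j
    have := congrFun (deriv_conj_conj (f := fun w => Φ w i j)) (x : ℂ)
    rw [Function.comp_apply, Function.comp_apply, Complex.conj_ofReal] at this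
    rw [← this]
    refine Filter.EventuallyEq.deriv_eq ?_
    filter_upwards [(isOpen_Γ m).mem_nhds hx] with w hw
    simp [hΦconj w hw]
  have hlin : (linearization m k y).map (starRingEnd ℂ) = linearization m k y := by
    ext i j
    exact ((isLocallyReal_hamVectorField hH i).partialDeriv j).conj_apply hyreal
  have htime : starRingEnd ℂ (timeDeriv m k x) = timeDeriv m k x := by
    have hr : starRingEnd ℂ (orbitR m k x) = orbitR m k x := by
      simpa [lagrangeOrbit] using congrFun (star_lagrangeOrbit m k x) (Sum.inl 0)
    simp [timeDeriv, hr, Complex.conj_ofNat]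
  have hL : (Matrix.of (fun i j => deriv (fun w => Φ w i j) x)
      + timeDeriv m k x • (Φ x * linearization m k y)).map (starRingEnd ℂ)
      = Matrix.of (fun i j => deriv (fun w => Φ w i j) x)
        + timeDeriv m k x • (Φ x * linearization m k y) := by
    have hprod : (Φ x * linearization m k y).map (starRingEnd ℂ)
        = Φ x * linearization m k y := by rw [Matrix.map_mul, hΦx, hlin]
    ext i j
    have hij := congrFun (congrFun hprod i) j
    rw [Matrix.map_apply] at hij
    simp [hderiv, htime, hij]
  have hdH : ∀ δ, dHamiltonian m k y (star δ) = starRingEnd ℂ (dHamiltonian m k y δ) := by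
    intro δ
    simp only [dHamiltonian, map_sum, map_mul, (hH.partialDeriv _).conj_apply hyreal,
      Pi.star_apply, starRingEnd_apply]
  let ℓ : Phase →ₗ[ℂ] ℂ := Fintype.linearCombination ℂ
    (fun i => partialDeriv i (hamiltonian m k) y)
  have hℓ : ∀ δ, ℓ δ = dHamiltonian m k y δ := fun δ => by
    simp [ℓ, Fintype.linearCombination_apply, dHamiltonian, mul_comm]
  refine Matrix.toLin'.injective (LinearMap.ext fun u => ?_)
  obtain ⟨δ, hδ, rfl⟩ := exists_mem_ker_eq (by simp) ℓ (Matrix.toLin' (Φ x)) (hamVectorField m k y)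
    (fun δ h1 h2 => (hΦker x hx δ (by rw [← hℓ, h1])).1 (by simpa using h2)) u
  rw [hℓ] at hδ
  simp only [Matrix.toLin'_apply]
  rw [← hΦ x hx δ hδ]
  have := congrArg star (hΦ x hx (star δ) (by rw [← hy, hdH, hδ, map_zero]))
  rw [star_mulVec_eq, star_mulVec_eq, star_mulVec_eq, hL, hΦx, star_star] at this
  exact this.symm

/-- Uniqueness of partial fraction decompositions, with the identity assumed on the real line. -/
theorem eq_zero_of_partialFractions {a b c p q r : ℂ} (hpq : p ≠ q) (hpr : p ≠ r) (hqr : q ≠ r)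
    (h : ∀ x : ℝ, (x : ℂ) ≠ p → (x : ℂ) ≠ q → (x : ℂ) ≠ r →
      ((x : ℂ) - p)⁻¹ * a + ((x : ℂ) - q)⁻¹ * b + ((x : ℂ) - r)⁻¹ * c = 0) :
    a = 0 ∧ b = 0 ∧ c = 0 := by
  open Polynomial in
  have hP : Polynomial.C a * (X - C q) * (X - C r) + Polynomial.C b * (X - C p) * (X - C r)
      + Polynomial.C c * (X - C p) * (X - C q) = 0 := by
    refine Polynomial.eq_zero_of_infinite_isRoot _ (Set.Infinite.mono (s :=
      Set.range Complex.ofReal \ {p, q, r}) ?_ ?_)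
    · rintro _ ⟨⟨x, rfl⟩, hx⟩
      simp only [Set.mem_insert_iff, Set.mem_singleton_iff, not_or] at hx
      have := h x hx.1 hx.2.1 hx.2.2
      have h1 := sub_ne_zero.2 hx.1
      have h2 := sub_ne_zero.2 hx.2.1
      have h3 := sub_ne_zero.2 hx.2.2
      field_simp at this
      simp only [Set.mem_ofPred_eq, Polynomial.IsRoot.def, Polynomial.eval_add, Polynomial.eval_mul,
        Polynomial.eval_sub, Polynomial.eval_X, Polynomial.eval_C]
      linear_combination this
    · exact (Set.infinite_range_of_injective Complex.ofReal_injective).sdiff (Set.toFinite _)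
  have hev := fun z => congrArg (Polynomial.eval z) hP
  simp only [Polynomial.eval_add, Polynomial.eval_mul, Polynomial.eval_sub, Polynomial.eval_X,
    Polynomial.eval_C, Polynomial.eval_zero] at hev
  refine ⟨?_, ?_, ?_⟩
  · simpa [sub_eq_zero, hpq, hpr] using hev p
  · simpa [sub_eq_zero, hpq.symm, hqr] using hev q
  · simpa [sub_eq_zero, hpr.symm, hqr.symm] using hev r

theorem hasRealStructure_of_isNormalVariationalEquation {m : Masses} {k : ℝ} (hk : k ≠ 0)
    {A B C : Matrix (Fin 4) (Fin 4) ℂ} (h : IsNormalVariationalEquation m k A B C) :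
    HasRealStructure A B C := by
  have hmat : ∀ x : ℝ, (x : ℂ) ∈ Γ m → coeffMatrix m (A.map (starRingEnd ℂ))
      (C.map (starRingEnd ℂ)) (B.map (starRingEnd ℂ)) x = coeffMatrix m A B C x := fun x hx => by
    rw [← conj_coeffMatrix_of_isNormalVariationalEquation hk h hx, conj_coeffMatrix,
      Complex.conj_ofReal]
  have key : ∀ i j, A.map (starRingEnd ℂ) i j - A i j = 0 ∧ C.map (starRingEnd ℂ) i j - B i j = 0 ∧
      B.map (starRingEnd ℂ) i j - C i j = 0 := fun i j => by
    refine eq_zero_of_partialFractions (p := z₀ m) (q := z₁ m) (r := z₂ m) (ofReal_ne_z₁ m _)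
      (ofReal_ne_z₂ m _) (z₁_ne_z₂ m) fun x h0 h1 h2 => ?_
    have := congrFun (congrFun (hmat x ⟨h0, h1, h2⟩) i) j
    simp only [coeffMatrix, Matrix.add_apply, Matrix.smul_apply, smul_eq_mul] at this
    linear_combination this
  refine hasRealStructure_iff.2 ⟨?_, ?_⟩
  · ext i j; exact sub_eq_zero.1 (key i j).1
  · ext i j; exact sub_eq_zero.1 (key i j).2.2

end ThreeBody

end

theorem mainTheorem2 (m : ThreeBody.Masses) (k : ℝ) (hk : k ≠ 0) :
    (∀ A B C : Matrix (Fin 4) (Fin 4) ℂ,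
      ThreeBody.IsNormalVariationalEquation m k A B C → ThreeBody.HasRealStructure A B C) ∧
    (∀ A B C : Matrix (Fin 4) (Fin 4) ℂ, ThreeBody.HasRealStructure A B C →
      ∀ γ₁ γ₂ : Path (0 : ℂ) 0,
        ThreeBody.IsGeneratorAround m (ThreeBody.z₁ m) γ₁ →
        ThreeBody.IsGeneratorAround m (ThreeBody.z₂ m) γ₂ →
        ∃ T₁ T₂ : Matrix.GeneralLinearGroup (Fin 4) ℂ,
          (∀ T, ThreeBody.IsMonodromyMatrix (ThreeBody.coeffMatrix m A B C) γ₁ T ↔ T = ↑T₁) ∧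
          (∀ T, ThreeBody.IsMonodromyMatrix (ThreeBody.coeffMatrix m A B C) γ₂ T ↔ T = ↑T₂) ∧
          T₂ = (Matrix.GeneralLinearGroup.map (starRingEnd ℂ) T₁)⁻¹) :=
  ⟨fun _ _ _ => ThreeBody.hasRealStructure_of_isNormalVariationalEquation hk,
    fun _ _ _ h _ _ => ThreeBody.monodromy_conj h⟩
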